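/- Fix $T>0$. A *blow-up function* is a non-decreasing $C^1$ function $\varphi:[0,T)\to[0,\infty)$ that is bounded below by a positive constant and satisfies $\varphi(t)\to\infty$ and $\int_0^t\varphi(s)\,ds\to\infty$ as $t\to T$. A signal $q$ is *prescribed-time exponentially convergent* if there are $0\le\tilde T<T$, $c>0$, $p>0$ and a blow-up function $\psi$ such that $\psi(t)\ge p\left(\frac{T}{T-t}\right)^2$ and $|q(t)|\le c\,e^{-\int_{\tilde T}^t\psi(s)ds}$ for all $t\in(\tilde T,T)$. A system $\dot x=f(x,t)$ is *PT-C* if there are a class $\mathcal{KL}$ function $\beta$ and a blow-up function $\mu$ such that $|x(t)|\le\beta(|x(0)|,\mu(t)-\mu(0))$ along every solution, for as long as it is defined in $[0,T)$. A continuous function $V(x,t)\ge 0$ is a *prescribed-time exponentially convergent Lyapunov certificate* for $\dot x=f(x,d,t)$ if for every solution $x$ on $[0,T)$, with any continuous input $d$, prescribed-time exponential convergence of $V(x(t),t)$ implies $x(t)\to0$ as $t\to T$. The certificate is *uniform* if $V(0,0)=0$ and the convergence it certifies is of the kind required in the definition of PT-C: for every blow-up function $\psi$ with $\psi(t)\ge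 p\left(\frac{T}{T-t}\right)^2$ on $[0,T)$ for some $p>0$, there are a class $\mathcal{KL}$ function $\beta$ and a blow-up function $\mu$ such that, for every $s\in(0,T]$, every continuous input, every solution $x$ on $[0,s)$ and every $c\ge 0$, if $V(x(t),t)\le c\,e^{-\int_0^t\psi(r)dr}$ on $[0,s)$ then $|x(t)|\le\beta(|x(0)|+c,\mu(t)-\mu(0))$ on $[0,s)$. **Theorem.** Consider the interconnection of $N$ systems $$\dot x_i=f_i(x_i,x_1,\ldots,x_{i-1},x_{i+1},\ldots,x_N,t),\qquad x_i\in\mathbb R^{n_i},\quad i=1,\ldots,N,$$ with the $f_i$ continuous for $t\in[0,T)$. Let $V_i(x_i,t)$ be a prescribed-time exponentially convergent Lyapunov certificate for the $i$-th system (with the other states as its input), $i=1,\dots,N$, such that along all solutions of the interconnection $$\dot V_i\le\varphi(t)\Big[-a_iV_i+\sum_{j\ne i}b_{i,j}V_j\Big],\qquad i=1,\ldots,N,$$ where $\varphi$ is a blow-up function with $\varphi(t)\ge p_0\left(\frac{T}{T-t}\right)^2$ on $[0,T)$, $p_0>0$, and where $a_i>0$ and $b_{i,j}>0$ ($j\ne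 i$) are constants. Let $A$ be the $N\times N$ matrix with diagonal entries $-a_i$ and off-diagonal entries $b_{i,j}$, and suppose that $A$ is strict Hurwitz (all eigenvalues have negative real part). Then $x(t)\to 0$ as $t\to T$ for every solution $x=(x_1,\dots,x_N)$ of the interconnection on $[0,T)$. If, moreover, the certificates $V_i$ are uniform, then the interconnection is PT-C. -/

import Mathlib

open Set Filter Topology

noncomputable section

/-- Class `𝒦` functions on `[0, ∞)`. -/
structure IsClassK (α : ℝ → ℝ) : Prop where
  continuousOn : ContinuousOn α (Ici 0)
  strictMonoOn : StrictMonoOn α (Ici 0)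
  map_zero : α 0 = 0

/-- Class `ℒ` functions on `[0, ∞)` (non-negativity follows from monotonicity and the limit). -/
structure IsClassL (σ : ℝ → ℝ) : Prop where
  continuousOn : ContinuousOn σ (Ici 0)
  antitoneOn : AntitoneOn σ (Ici 0)
  tendsto_zero : Tendsto σ atTop (𝓝 0)

/-- Class `𝒦ℒ` functions on `[0, ∞) × [0, ∞)`. -/
structure IsClassKL (β : ℝ → ℝ → ℝ) : Prop where
  classK : ∀ s, 0 ≤ s → IsClassK (fun r => β r s)
  classL : ∀ r, 0 ≤ r → IsClassL (fun s => β r s)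

/-- Blow-up functions on `[0, T)`; values outside `[0, T)` are irrelevant. -/
structure IsBlowUp (T : ℝ) (φ : ℝ → ℝ) : Prop where
  monotoneOn : MonotoneOn φ (Ico 0 T)
  contDiffOn : ContDiffOn ℝ 1 φ (Ico 0 T)
  lower_bound : ∃ φ₀ : ℝ, 0 < φ₀ ∧ ∀ t ∈ Ico 0 T, φ₀ ≤ φ t
  tendsto_atTop : Tendsto φ (𝓝[<] T) atTop
  integral_tendsto_atTop : Tendsto (fun t => ∫ s in (0 : ℝ)..t, φ s) (𝓝[<] T) atTop

/-- `x` is a solution on `[0, s)` of `ẋ = f(x, t)`. -/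
def IsSolution {X : Type*} [NormedAddCommGroup X] [NormedSpace ℝ X]
    (f : X → ℝ → X) (s : ℝ) (x : ℝ → X) : Prop :=
  ∀ t ∈ Ico 0 s, HasDerivWithinAt x (f (x t) t) (Ico 0 s) t

/-- `x` is a solution on `[0, s)` of `ẋ = f(x, d, t)` with the continuous input signal `d`. -/
def IsSolutionWithInput {X D : Type*} [NormedAddCommGroup X] [NormedSpace ℝ X]
    [TopologicalSpace D] (f : X → D → ℝ → X) (s : ℝ) (x : ℝ → X) (d : ℝ → D) : Prop :=
  ContinuousOn d (Ico 0 s) ∧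
    ∀ t ∈ Ico 0 s, HasDerivWithinAt x (f (x t) (d t) t) (Ico 0 s) t

/-- Prescribed-time convergent (PT-C) system `ẋ = f(x, t)`: one class `𝒦ℒ` function `β` and one
blow-up function `μ` such that `|x(t)| ≤ β(|x(0)|, μ(t) - μ(0))` along every solution. The bound
is required of every solution, on whatever interval `[0, s)`, `s ≤ T`, it is defined; so a
solution that escapes to infinity before time `T` is excluded, not ignored. -/
def IsPTC {X : Type*} [NormedAddCommGroup X] [NormedSpace ℝ X]
    (T : ℝ) (f : X → ℝ → X) : Prop :=
  ∃ β : ℝ → ℝ → ℝ, ∃ μ : ℝ → ℝ, IsClassKL β ∧ IsBlowUp T μ ∧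
    ∀ s ∈ Ioc 0 T, ∀ x : ℝ → X, IsSolution f s x →
      ∀ t ∈ Ico 0 s, ‖x t‖ ≤ β ‖x 0‖ (μ t - μ 0)

/-- Prescribed-time exponentially convergent signal. -/
def IsPTExpConvergent (T : ℝ) (q : ℝ → ℝ) : Prop :=
  ∃ T' ∈ Ico 0 T, ∃ c > 0, ∃ φ : ℝ → ℝ, IsBlowUp T φ ∧
    (∃ p₀ > 0, ∀ t ∈ Ioo T' T, p₀ * (T / (T - t)) ^ 2 ≤ φ t) ∧
    ∀ t ∈ Ioo T' T, |q t| ≤ c * Real.exp (-∫ s in T'..t, φ s)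

/-- Prescribed-time exponentially convergent Lyapunov certificate `V(x, t)` of `ẋ = f(x, d, t)`:
along the solutions on `[0, T)`, prescribed-time exponential convergence of `V(x(t), t)` implies
that `x(t) → 0` as `t → T`. -/
structure IsPTExpCertificate {X D : Type*} [NormedAddCommGroup X] [NormedSpace ℝ X]
    [TopologicalSpace D] (T : ℝ) (f : X → D → ℝ → X) (V : X → ℝ → ℝ) : Prop where
  nonneg : ∀ x, ∀ t ∈ Ico 0 T, 0 ≤ V x t
  continuousOn : ContinuousOn (fun p : X × ℝ => V p.1 p.2) (univ ×ˢ Ico 0 T)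
  tendsto_zero : ∀ (x : ℝ → X) (d : ℝ → D), IsSolutionWithInput f T x d →
    IsPTExpConvergent T (fun t => V (x t) t) → Tendsto x (𝓝[<] T) (𝓝 0)

/-- The certificate is uniform: it vanishes at the origin at the initial time, and the convergence
of `x` that it certifies is uniform in the sense of the definition of a PT-C system. That is, from
`V(x(t), t) ≤ c exp (-∫₀ᵗ φ)` it follows that `|x(t)| ≤ β(|x(0)| + c, μ(t) - μ(0))`, where the
class `𝒦ℒ` function `β` and the blow-up function `μ` depend on `φ` but neither on the solution,
nor on the input, nor on `c`. -/
structure IsUniformCertificate {X D : Type*} [NormedAddCommGroup X] [NormedSpace ℝ X]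
    [TopologicalSpace D] (T : ℝ) (f : X → D → ℝ → X) (V : X → ℝ → ℝ) : Prop where
  map_zero : V 0 0 = 0
  bound : ∀ φ : ℝ → ℝ, IsBlowUp T φ →
    (∃ p₀ > 0, ∀ t ∈ Ico 0 T, p₀ * (T / (T - t)) ^ 2 ≤ φ t) →
    ∃ β : ℝ → ℝ → ℝ, ∃ μ : ℝ → ℝ, IsClassKL β ∧ IsBlowUp T μ ∧
      ∀ s ∈ Ioc 0 T, ∀ (x : ℝ → X) (d : ℝ → D), IsSolutionWithInput f s x d →
        ∀ c ≥ 0, (∀ t ∈ Ico 0 s, V (x t) t ≤ c * Real.exp (-∫ r in (0 : ℝ)..t, φ r)) →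
          ∀ t ∈ Ico 0 s, ‖x t‖ ≤ β (‖x 0‖ + c) (μ t - μ 0)

/-- The state of the `i`-th of `N` systems lives in `ℝ ^ (n i)` with the Euclidean norm. -/
abbrev SubState {N : ℕ} (n : Fin N → ℕ) (i : Fin N) : Type := EuclideanSpace ℝ (Fin (n i))

/-- The input of the `i`-th system: the states of all the other systems. -/
abbrev OtherStates {N : ℕ} (n : Fin N → ℕ) (i : Fin N) : Type :=
  (j : {j : Fin N // j ≠ i}) → SubState n j.1

/-- The stacked state `(x₁, …, x_N)`, with the Euclidean norm. -/
abbrev TotalState {N : ℕ} (n : Fin N → ℕ) : Type := PiLp 2 (fun i : Fin N => SubState n i)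

/-- The vector field of the interconnection `ẋᵢ = fᵢ(xᵢ, (xⱼ)_{j ≠ i}, t)`. -/
def interconnection {N : ℕ} {n : Fin N → ℕ}
    (f : (i : Fin N) → SubState n i → OtherStates n i → ℝ → SubState n i) :
    TotalState n → ℝ → TotalState n :=
  fun x t => WithLp.toLp 2 (fun i => f i (x i) (fun j => x j.1) t)

/-- The matrix with diagonal entries `-aᵢ` and off-diagonal entries `bᵢⱼ`. -/
def gainMatrix {N : ℕ} (a : Fin N → ℝ) (b : Fin N → Fin N → ℝ) : Matrix (Fin N) (Fin N) ℝ :=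
  Matrix.of fun i j => if i = j then -a i else b i j

/-- Strict Hurwitz matrix: all complex eigenvalues lie in the open left half plane. -/
def IsHurwitz {N : ℕ} (A : Matrix (Fin N) (Fin N) ℝ) : Prop :=
  ∀ z ∈ spectrum ℂ (A.map (fun r : ℝ => (r : ℂ))), z.re < 0

end

/-! A weighted sum `W = ∑ vᵢ Vᵢ` serves as one Lyapunov function for the whole interconnection.
Since `A` is Hurwitz with non-negative off-diagonal entries, there is `v > 0` with `vᵀ A = -1ᵀ`
(`exists_pos_vecMul_eq_neg_one`). Hence `W' ≤ -φ ∑ Vᵢ ≤ -l φ W` once `l vᵢ ≤ 1`, and comparison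
gives `Vᵢ ≤ W / vᵢ ≤ (W(0) / vᵢ) exp(-∫ l φ)` (`le_exp_of_deriv_le_gainMatrix`). As `l φ` is again
an admissible rate, each certificate yields `xᵢ → 0`.

In the uniform case `W(0)` is bounded by a monotone function of `‖x(0)‖` vanishing at zero, so each
`‖xᵢ‖` has a class `𝒦ℒ` bound with its own clock `μᵢ`. `exists_isClassKL_sum` merges these bounds by
rewriting every clock in terms of `T / (T - t)`. -/

/-! ### Positive left vectors for Hurwitz matrices with non-negative off-diagonal entries -/

open Matrix in
/-- For a Metzler matrix, a solution of `vᵀ (t - A) = 1ᵀ` that is non-negative is positive. -/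
lemma pos_of_vecMul_eq_one_of_nonneg {N : ℕ} {B : Matrix (Fin N) (Fin N) ℝ}
    (hB : ∀ i j, i ≠ j → B i j ≤ 0) {v : Fin N → ℝ} (hv : v ᵥ* B = 1) (h0 : ∀ i, 0 ≤ v i)
    (i : Fin N) : 0 < v i := by
  -- If `v i = 0`, column `i` of the equation loses its diagonal term, and only non-positive terms
  -- are left to sum to `1`.
  refine lt_of_le_of_ne (h0 i) fun h => ?_
  have h1 : ∑ j, v j * B j i = 1 := congrFun hv i
  have h2 : ∑ j, v j * B j i ≤ 0 := by
    refine Finset.sum_nonpos fun j _ => ?_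
    by_cases hj : j = i
    · subst hj; simp [← h]
    · exact mul_nonpos_of_nonneg_of_nonpos (h0 j) (hB j i hj)
  linarith

open Matrix in
/-- A solution of `vᵀ B = 1ᵀ` is positive if `B` has non-positive off-diagonal entries and
positive column sums. -/
lemma pos_of_vecMul_eq_one_of_colSum_pos {N : ℕ} {B : Matrix (Fin N) (Fin N) ℝ}
    (hB : ∀ i j, i ≠ j → B i j ≤ 0) (hsum : ∀ i, 0 < ∑ j, B j i) {v : Fin N → ℝ}
    (hv : v ᵥ* B = 1) (i : Fin N) : 0 < v i := by
  have : Nonempty (Fin N) := ⟨i⟩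
  obtain ⟨k, hk⟩ := Finite.exists_min v
  have h1 : ∑ j, v j * B j k = 1 := congrFun hv k
  -- Lowering every `v j` to the minimum `v k` can only raise the off-diagonal terms, so `1 ≤ v k *
  -- ∑ j, B j k`.
  have h2 : ∑ j, v j * B j k ≤ ∑ j, v k * B j k := by
    refine Finset.sum_le_sum fun j _ => ?_
    by_cases hj : j = k
    · subst hj; exact le_rfl
    · exact mul_le_mul_of_nonpos_right (hk j) (hB j k hj)
  rw [← Finset.mul_sum, h1] at h2
  have h3 : 0 < v k := by
    by_contra h
    have := mul_nonpos_of_nonpos_of_nonneg (not_lt.1 h) (hsum k).le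
    linarith
  exact h3.trans_le (hk i)

open Matrix in
/-- A strict Hurwitz matrix with non-negative off-diagonal entries has a positive vector `v` with
`vᵀ A = -1ᵀ`. -/
lemma exists_pos_vecMul_eq_neg_one {N : ℕ} {A : Matrix (Fin N) (Fin N) ℝ}
    (hoff : ∀ i j, i ≠ j → 0 ≤ A i j) (hA : IsHurwitz A) :
    ∃ v : Fin N → ℝ, (∀ i, 0 < v i) ∧ v ᵥ* A = -1 := by
  set B : ℝ → Matrix (Fin N) (Fin N) ℝ := fun t => t • (1 : Matrix (Fin N) (Fin N) ℝ) - A with hBdef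
  have hBoff : ∀ t i j, i ≠ j → B t i j ≤ 0 := by
    intro t i j hij
    simp [hBdef, hij, hoff i j hij]
  -- A singular `B t` would make `t ≥ 0` an eigenvalue of `A`.
  have hdet : ∀ t, 0 ≤ t → IsUnit (B t).det := by
    intro t ht
    rw [isUnit_iff_ne_zero]
    intro h
    have hz : (t : ℂ) ∈ spectrum ℂ (A.map (fun r : ℝ => (r : ℂ))) := by
      rw [spectrum.mem_iff, Matrix.isUnit_iff_isUnit_det, isUnit_iff_ne_zero, not_not]
      have h2 : algebraMap ℂ (Matrix (Fin N) (Fin N) ℂ) t - A.map (fun r : ℝ => (r : ℂ))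
          = Complex.ofRealHom.mapMatrix (B t) := by
        ext i j
        by_cases hij : i = j
        · subst hij; simp [hBdef, Matrix.algebraMap_matrix_apply]
        · simp [hBdef, Matrix.algebraMap_matrix_apply, hij]
      rw [h2, ← RingHom.map_det, h, map_zero]
    have := hA _ hz
    simp at this
    linarith
  set v : ℝ → Fin N → ℝ := fun t => 1 ᵥ* (B t)⁻¹ with hvdef
  have hv : ∀ t, 0 ≤ t → v t ᵥ* B t = 1 := by
    intro t ht
    simp [hvdef, Matrix.vecMul_vecMul, Matrix.nonsing_inv_mul _ (hdet t ht)]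
  have hBc : Continuous B := by fun_prop
  have hvc : ContinuousOn v (Ici 0) := by
    have h1 : ContinuousOn (fun t => (B t)⁻¹) (Ici 0) := by
      simp only [Matrix.inv_def, Ring.inverse_eq_inv']
      exact (hBc.matrix_det.continuousOn.inv₀ fun t ht => (hdet t ht).ne_zero).smul
        hBc.matrix_adjugate.continuousOn
    exact (continuous_const.matrix_vecMul continuous_id).comp_continuousOn h1
  have hclosed : IsClosed {u : Fin N → ℝ | ∀ i, 0 ≤ u i} := by
    simp only [ofPred_forall]
    exact isClosed_iInter fun i => isClosed_le continuous_const (continuous_apply i)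
  have hopen : IsOpen {u : Fin N → ℝ | ∀ i, 0 < u i} := by
    simp only [ofPred_forall]
    exact isOpen_iInter_of_finite fun i => isOpen_lt continuous_const (continuous_apply i)
  -- Continuation in `t`: positivity of `v t` is an open condition, and also closed because it is
  -- equivalent to non-negativity. It holds for large `t`, hence on all of the connected set `[0,
  -- ∞)`, in particular at `t = 0`.
  have hmem : ∀ t : Ici (0 : ℝ), ∀ i, 0 < v t i := by
    have hcl : IsClopen {t : Ici (0 : ℝ) | ∀ i, 0 < v t i} := by
      refine ⟨?_, hopen.preimage hvc.domRestrict⟩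
      convert hclosed.preimage hvc.domRestrict using 1
      ext t
      exact ⟨fun h i => (h i).le,
        fun h => pos_of_vecMul_eq_one_of_nonneg (hBoff t) (hv t t.2) h⟩
    have : PreconnectedSpace (Ici (0 : ℝ)) := Subtype.preconnectedSpace isPreconnected_Ici
    refine fun t => (eq_univ_iff_forall.1 (hcl.eq_univ ?_)) t
    -- `M` dominates every column sum of `A`, so `B (M + 1)` has column sums at least `1`.
    set M : ℝ := ∑ i, ∑ j, |A j i| with hM
    have hM0 : 0 ≤ M := Finset.sum_nonneg fun i _ => Finset.sum_nonneg fun j _ => abs_nonneg _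
    refine ⟨⟨M + 1, by simp only [mem_Ici]; linarith⟩, ?_⟩
    refine pos_of_vecMul_eq_one_of_colSum_pos (hBoff _) (fun i => ?_) (hv _ ?_)
    · have h1 : ∑ j, B (M + 1) j i = M + 1 - ∑ j, A j i := by
        simp [hBdef, Finset.sum_sub_distrib, Matrix.one_apply]
      have h2 : ∑ j, A j i ≤ ∑ j, |A j i| := Finset.sum_le_sum fun j _ => le_abs_self _
      have h3 : ∑ j, |A j i| ≤ M :=
        Finset.single_le_sum (f := fun i => ∑ j, |A j i|)
          (fun i _ => Finset.sum_nonneg fun j _ => abs_nonneg _) (Finset.mem_univ i)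
      simp only [h1]
      linarith
    · simp only; linarith
  refine ⟨v 0, hmem ⟨0, self_mem_Ici⟩, ?_⟩
  have h := hv 0 le_rfl
  simp only [hBdef, zero_smul, zero_sub, Matrix.vecMul_neg] at h
  rw [← h, neg_neg]

/-! ### Comparison and blow-up functions -/

/-- Comparison lemma for the linear differential inequality `w' ≤ -φ w`. -/
lemma le_mul_exp_neg_integral {s : ℝ} {φ w : ℝ → ℝ} (hφ : ContinuousOn φ (Ico 0 s))
    (hw : ∀ t ∈ Ico 0 s, ∃ w' : ℝ, HasDerivWithinAt w w' (Ico 0 s) t ∧ w' ≤ -φ t * w t) :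
    ∀ t ∈ Ico 0 s, w t ≤ w 0 * Real.exp (-∫ r in (0 : ℝ)..t, φ r) := by
  intro t ht
  have hsub : Icc 0 t ⊆ Ico 0 s := fun r hr => ⟨hr.1, hr.2.trans_lt ht.2⟩
  set Φ : ℝ → ℝ := fun r => ∫ u in (0 : ℝ)..r, φ u with hΦ
  have hint : ∀ r ∈ Ico 0 s, IntervalIntegrable φ MeasureTheory.volume 0 r := fun r hr =>
    (hφ.mono (by rw [uIcc_of_le hr.1]; exact fun u hu => ⟨hu.1, hu.2.trans_lt hr.2⟩)).intervalIntegrable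
  -- Integrating factor: the derivative is `(w' + φ w) exp Φ ≤ 0`.
  have hanti : AntitoneOn (fun r => w r * Real.exp (Φ r)) (Icc 0 t) := by
    have hder : ∀ r ∈ interior (Icc 0 t), ∃ d, HasDerivAt (fun r => w r * Real.exp (Φ r)) d r
        ∧ d ≤ 0 := by
      intro r hr
      rw [interior_Icc] at hr
      have hrs : r ∈ Ioo 0 s := ⟨hr.1, hr.2.trans ht.2⟩
      have hnhds : Ico 0 s ∈ 𝓝 r := Ico_mem_nhds hrs.1 hrs.2
      obtain ⟨w', hw1, hw2⟩ := hw r ⟨hrs.1.le, hrs.2⟩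
      have hΦd : HasDerivAt Φ (φ r) r := by
        refine intervalIntegral.integral_hasDerivAt_right (hint r ⟨hrs.1.le, hrs.2⟩) ?_
          (hφ.continuousAt hnhds)
        exact (hφ.mono Ioo_subset_Ico_self).stronglyMeasurableAtFilter isOpen_Ioo _ hrs
      refine ⟨_, (hw1.hasDerivAt hnhds).mul hΦd.exp, ?_⟩
      have : w' * Real.exp (Φ r) + w r * (Real.exp (Φ r) * φ r)
          = (w' + φ r * w r) * Real.exp (Φ r) := by ring
      rw [this]
      exact mul_nonpos_of_nonpos_of_nonneg (by linarith) (Real.exp_pos _).le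
    refine antitoneOn_of_deriv_nonpos (convex_Icc 0 t) ?_ ?_ ?_
    · refine ContinuousOn.mul ?_ ?_
      · intro r hr
        obtain ⟨w', hw1, -⟩ := hw r (hsub hr)
        exact hw1.continuousWithinAt.mono hsub
      · refine Real.continuous_exp.comp_continuousOn ?_
        have := intervalIntegral.continuousOn_primitive_interval (μ := MeasureTheory.volume)
          (f := φ) (a := 0) (b := t) (by
            rw [uIcc_of_le ht.1]
            exact (hφ.mono hsub).integrableOn_Icc)
        rwa [uIcc_of_le ht.1] at this
    · intro r hr
      obtain ⟨d, hd, -⟩ := hder r hr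
      exact hd.differentiableAt.differentiableWithinAt
    · intro r hr
      obtain ⟨d, hd, hd0⟩ := hder r hr
      rwa [hd.deriv]
  have h := hanti ⟨le_rfl, ht.1⟩ ⟨ht.1, le_rfl⟩ ht.1
  simp only [hΦ, intervalIntegral.integral_same, Real.exp_zero, mul_one] at h
  rw [Real.exp_neg, ← div_eq_mul_inv, le_div_iff₀ (Real.exp_pos _)]
  exact h

lemma IsBlowUp.const_mul {T : ℝ} {φ : ℝ → ℝ} (hφ : IsBlowUp T φ) {l : ℝ} (hl : 0 < l) :
    IsBlowUp T (fun t => l * φ t) where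
  monotoneOn := fun x hx y hy hxy => mul_le_mul_of_nonneg_left (hφ.monotoneOn hx hy hxy) hl.le
  contDiffOn := contDiffOn_const.mul hφ.contDiffOn
  lower_bound := by
    obtain ⟨c, hc, h⟩ := hφ.lower_bound
    exact ⟨l * c, mul_pos hl hc, fun t ht => mul_le_mul_of_nonneg_left (h t ht) hl.le⟩
  tendsto_atTop := hφ.tendsto_atTop.const_mul_atTop hl
  integral_tendsto_atTop := by
    simp only [intervalIntegral.integral_const_mul]
    exact hφ.integral_tendsto_atTop.const_mul_atTop hl

lemma tendsto_div_sub_nhdsLT_atTop {T : ℝ} (hT : 0 < T) :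
    Tendsto (fun t => T / (T - t)) (𝓝[<] T) atTop := by
  have h : Tendsto (fun t => T - t) (𝓝[<] T) (𝓝[>] 0) := by
    refine tendsto_nhdsWithin_iff.2 ⟨?_, ?_⟩
    · have : Tendsto (fun t => T - t) (𝓝 T) (𝓝 (T - T)) :=
        (continuous_const.sub continuous_id).tendsto T
      rw [sub_self] at this
      exact this.mono_left nhdsWithin_le_nhds
    · filter_upwards [self_mem_nhdsWithin] with t ht
      exact sub_pos.2 (mem_Iio.1 ht)
  simp only [div_eq_mul_inv]
  exact (tendsto_inv_nhdsGT_zero.comp h).const_mul_atTop hT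

/-- The primitive is `T log (T / (T - t))`, which diverges at `T`. This function is the common clock
of the final estimate. -/
lemma isBlowUp_div_sub {T : ℝ} (hT : 0 < T) : IsBlowUp T (fun t => T / (T - t)) where
  monotoneOn := fun x _ y hy hxy =>
    div_le_div_of_nonneg_left hT.le (sub_pos.2 hy.2) (by linarith)
  contDiffOn := contDiffOn_const.div (contDiffOn_const.sub contDiffOn_id)
    fun t ht => (sub_pos.2 ht.2).ne'
  lower_bound := ⟨1, one_pos, fun t ht => by
    rw [le_div_iff₀ (sub_pos.2 ht.2)]; linarith [ht.1]⟩
  tendsto_atTop := tendsto_div_sub_nhdsLT_atTop hT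
  integral_tendsto_atTop := by
    have h : ∀ t ∈ Ico 0 T, ∫ s in (0 : ℝ)..t, T / (T - s) = T * Real.log (T / (T - t)) := by
      intro t ht
      have hder : ∀ r ∈ uIcc 0 t, HasDerivAt (fun r => -T * Real.log (T - r)) (T / (T - r)) r := by
        intro r hr
        rw [uIcc_of_le ht.1] at hr
        have hne : T - r ≠ 0 := (sub_pos.2 (hr.2.trans_lt ht.2)).ne'
        have := (((hasDerivAt_id r).const_sub T).log hne).const_mul (-T)
        rw [show T / (T - r) = -T * (-1 / (T - r)) by ring]
        exact this
      rw [intervalIntegral.integral_eq_sub_of_hasDerivAt hder]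
      · rw [Real.log_div hT.ne' (sub_pos.2 ht.2).ne']
        simp only [sub_zero]
        ring
      · refine ContinuousOn.intervalIntegrable ?_
        rw [uIcc_of_le ht.1]
        exact continuousOn_const.div (continuousOn_const.sub continuousOn_id)
          fun r hr => (sub_pos.2 (hr.2.trans_lt ht.2)).ne'
    refine ((Real.tendsto_log_atTop.comp (tendsto_div_sub_nhdsLT_atTop hT)).const_mul_atTop
      hT).congr' ?_
    filter_upwards [Ico_mem_nhdsLT hT] with t ht
    exact (h t ht).symm

/-! ### Class `𝒦ℒ` bounds -/

/-- A continuous function on a finite-dimensional space that vanishes at the origin is bounded by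
a continuous monotone function of the norm that vanishes at zero. -/
lemma exists_monotone_bound_of_continuous {E : Type*} [NormedAddCommGroup E] [NormedSpace ℝ E]
    [ProperSpace E] {h : E → ℝ} (hc : Continuous h) (h0 : h 0 = 0) :
    ∃ α : ℝ → ℝ, Continuous α ∧ MonotoneOn α (Ici 0) ∧ α 0 = 0 ∧ ∀ x, h x ≤ α ‖x‖ := by
  have hK : IsCompact (Metric.closedBall (0 : E) 1) := isCompact_closedBall 0 1
  have hne : (Metric.closedBall (0 : E) 1).Nonempty := ⟨0, by simp⟩
  have hle : ∀ r : ℝ, ∀ u ∈ Metric.closedBall (0 : E) 1,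
      h (r • u) ≤ sSup ((fun u => h (r • u)) '' Metric.closedBall 0 1) := fun r u hu =>
    le_csSup (hK.image (by fun_prop)).bddAbove (mem_image_of_mem _ hu)
  -- The supremum of `h` over the ball of radius `r`, rescaled to the unit ball: the compact set no
  -- longer depends on `r`, which gives continuity in `r`.
  refine ⟨fun r => sSup ((fun u : E => h (r • u)) '' Metric.closedBall 0 1), ?_, ?_, ?_, ?_⟩
  · exact hK.continuous_sSup (f := fun (r : ℝ) (u : E) => h (r • u)) (by fun_prop)
  · intro r hr r' hr' hrr
    refine csSup_le (hne.image _) ?_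
    rintro _ ⟨u, hu, rfl⟩
    rcases eq_or_lt_of_le (show 0 ≤ r' from hr') with h' | h'
    · have : r = r' := le_antisymm hrr (h' ▸ hr)
      rw [this]
      exact hle r' u hu
    · have : r • u = r' • ((r / r') • u) := by
        rw [smul_smul, mul_div_cancel₀ _ h'.ne']
      simp only [this]
      refine hle r' _ ?_
      rw [mem_closedBall_zero_iff] at hu ⊢
      rw [norm_smul, Real.norm_of_nonneg (div_nonneg hr h'.le)]
      exact mul_le_one₀ ((div_le_one h').2 hrr) (norm_nonneg _) hu
  · simp [h0, hne.image_const]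
  · intro x
    by_cases hx : x = 0
    · subst hx
      simp [h0, hne.image_const]
    · have hx' : ‖x‖ ≠ 0 := norm_ne_zero_iff.2 hx
      have : x = ‖x‖ • (‖x‖⁻¹ • x) := by rw [smul_smul, mul_inv_cancel₀ hx', one_smul]
      conv_lhs => rw [this]
      refine hle ‖x‖ _ ?_
      rw [mem_closedBall_zero_iff, norm_smul, norm_inv, norm_norm, inv_mul_cancel₀ hx']

lemma IsClassKL.nonneg {β : ℝ → ℝ → ℝ} (hβ : IsClassKL β) {r s : ℝ} (hr : 0 ≤ r) (hs : 0 ≤ s) :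
    0 ≤ β r s := by
  have h := (hβ.classK s hs).strictMonoOn.monotoneOn self_mem_Ici hr hr
  simpa only [(hβ.classK s hs).map_zero] using h

/-- Class `𝒦ℒ` functions with different blow-up functions as their clocks are dominated by one
class `𝒦ℒ` function whose clock is the blow-up function `T / (T - t)`. -/
lemma exists_isClassKL_sum {T : ℝ} (hT : 0 < T) {ι : Type*} [Fintype ι] {β : ι → ℝ → ℝ → ℝ}
    {μ g : ι → ℝ → ℝ} (hβ : ∀ i, IsClassKL (β i)) (hμ : ∀ i, IsBlowUp T (μ i))
    (hgc : ∀ i, Continuous (g i)) (hgm : ∀ i, MonotoneOn (g i) (Ici 0)) (hg0 : ∀ i, g i 0 = 0) :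
    ∃ γ : ℝ → ℝ → ℝ, IsClassKL γ ∧ ∀ r, 0 ≤ r → ∀ t ∈ Ico 0 T,
      ∑ i, β i (g i r) (μ i t - μ i 0) ≤ γ r (T / (T - t) - T / (T - 0)) := by
  -- `τ` inverts `t ↦ T / (T - t) - 1`, so `η i` below is the `i`-th clock as a function of the
  -- common one.
  set τ : ℝ → ℝ := fun σ => T * (1 - (1 + σ)⁻¹) with hτ
  have hpos : ∀ σ ∈ Ici (0 : ℝ), (0 : ℝ) < 1 + σ := fun σ hσ => by
    have : (0 : ℝ) ≤ σ := hσ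
    linarith
  have hτmem : MapsTo τ (Ici 0) (Ico 0 T) := by
    intro σ hσ
    have h1 := inv_pos.2 (hpos σ hσ)
    have h2 : (1 + σ)⁻¹ ≤ 1 := inv_le_one_of_one_le₀ (by simpa using hσ)
    exact ⟨mul_nonneg hT.le (by linarith), by simp only [hτ]; nlinarith⟩
  have hinvc : ContinuousOn (fun σ : ℝ => (1 + σ)⁻¹) (Ici 0) :=
    (continuousOn_const.add continuousOn_id).inv₀ fun σ hσ => (hpos σ hσ).ne'
  have hinva : AntitoneOn (fun σ : ℝ => (1 + σ)⁻¹) (Ici 0) := fun x hx y _ hxy =>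
    inv_anti₀ (hpos x hx) (by linarith)
  have hinvt : Tendsto (fun σ : ℝ => (1 + σ)⁻¹) atTop (𝓝 0) :=
    tendsto_inv_atTop_zero.comp (tendsto_atTop_add_const_left _ _ tendsto_id)
  have hτc : ContinuousOn τ (Ici 0) := continuousOn_const.mul (continuousOn_const.sub hinvc)
  have hτm : MonotoneOn τ (Ici 0) := fun x hx y hy hxy =>
    mul_le_mul_of_nonneg_left (sub_le_sub_left (hinva hx hy hxy) 1) hT.le
  have hτt : Tendsto τ atTop (𝓝[<] T) := by
    refine tendsto_nhdsWithin_iff.2 ⟨?_, ?_⟩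
    · simpa using (hinvt.const_sub 1).const_mul T
    · filter_upwards [Ici_mem_atTop (0 : ℝ)] with σ hσ
      exact (hτmem hσ).2
  set η : ι → ℝ → ℝ := fun i σ => μ i (τ σ) - μ i 0 with hη
  have h0T : (0 : ℝ) ∈ Ico 0 T := ⟨le_rfl, hT⟩
  have hηm : ∀ i, MonotoneOn (η i) (Ici 0) := fun i x hx y hy hxy =>
    sub_le_sub_right ((hμ i).monotoneOn (hτmem hx) (hτmem hy) (hτm hx hy hxy)) _
  have hηmem : ∀ i, MapsTo (η i) (Ici 0) (Ici 0) := fun i σ hσ =>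
    sub_nonneg.2 ((hμ i).monotoneOn h0T (hτmem hσ) (hτmem hσ).1)
  have hηc : ∀ i, ContinuousOn (η i) (Ici 0) := fun i =>
    ((hμ i).contDiffOn.continuousOn.comp hτc hτmem).sub continuousOn_const
  have hηt : ∀ i, Tendsto (η i) atTop atTop := fun i =>
    tendsto_atTop_add_const_right _ _ ((hμ i).tendsto_atTop.comp hτt)
  have hgmem : ∀ i, MapsTo (g i) (Ici 0) (Ici 0) := fun i r hr => by
    have := hgm i self_mem_Ici hr hr
    rwa [hg0 i] at this
  -- The extra term `r / (1 + σ)` makes the sum strictly increasing in `r`, even if `g i` is only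
  -- monotone or `ι` is empty.
  refine ⟨fun r σ => r * (1 + σ)⁻¹ + ∑ i, β i (g i r) (η i σ), ⟨fun σ hσ => ?_, fun r hr => ?_⟩, ?_⟩
  · refine ⟨?_, ?_, ?_⟩
    · refine (continuousOn_id.mul continuousOn_const).add (continuousOn_finsetSum _ fun i _ => ?_)
      exact ((hβ i).classK _ (hηmem i hσ)).continuousOn.comp (hgc i).continuousOn (hgmem i)
    · intro x hx y hy hxy
      refine add_lt_add_of_lt_of_le (mul_lt_mul_of_pos_right hxy (inv_pos.2 (hpos σ hσ))) ?_
      refine Finset.sum_le_sum fun i _ => ?_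
      exact ((hβ i).classK _ (hηmem i hσ)).strictMonoOn.monotoneOn (hgmem i hx) (hgmem i hy)
        (hgm i hx hy hxy.le)
    · simp only [zero_mul, zero_add]
      refine Finset.sum_eq_zero fun i _ => ?_
      rw [hg0 i]
      exact ((hβ i).classK _ (hηmem i hσ)).map_zero
  · refine ⟨?_, ?_, ?_⟩
    · refine (continuousOn_const.mul hinvc).add (continuousOn_finsetSum _ fun i _ => ?_)
      exact ((hβ i).classL _ (hgmem i hr)).continuousOn.comp (hηc i) (hηmem i)
    · intro x hx y hy hxy
      refine add_le_add (mul_le_mul_of_nonneg_left (hinva hx hy hxy) hr) ?_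
      refine Finset.sum_le_sum fun i _ => ?_
      exact ((hβ i).classL _ (hgmem i hr)).antitoneOn (hηmem i hx) (hηmem i hy) (hηm i hx hy hxy)
    · have h1 : Tendsto (fun σ => ∑ i, β i (g i r) (η i σ)) atTop (𝓝 (∑ _i : ι, (0 : ℝ))) :=
        tendsto_finsetSum _ fun i _ =>
          ((hβ i).classL _ (hgmem i hr)).tendsto_zero.comp (hηt i)
      simpa using (hinvt.const_mul r).add h1
  · intro r hr t ht
    have hTt : 0 < T - t := sub_pos.2 ht.2
    set σ := T / (T - t) - T / (T - 0) with hσdef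
    have h1 : 1 + σ = T / (T - t) := by
      rw [hσdef, sub_zero, div_self hT.ne']; ring
    have h2 : τ σ = t := by
      simp only [hτ, h1, inv_div]
      field_simp
      ring
    have h3 : (0 : ℝ) ≤ r * (1 + σ)⁻¹ := by
      rw [h1]; positivity
    have h4 : ∀ i, η i σ = μ i t - μ i 0 := fun i => by simp only [hη, h2]
    simp only [h4]
    linarith

/-! ### The interconnection -/

lemma norm_le_sum_norm_apply {N : ℕ} {n : Fin N → ℕ} (x : TotalState n) :
    ‖x‖ ≤ ∑ i, ‖x i‖ := by
  rw [PiLp.norm_eq_of_L2, Real.sqrt_le_left (Finset.sum_nonneg fun i _ => norm_nonneg _)]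
  exact Finset.sum_sq_le_sq_sum_of_nonneg fun i _ => norm_nonneg _

/-- The components of a solution of the interconnection solve the subsystems. -/
lemma IsSolution.component {N : ℕ} {n : Fin N → ℕ}
    {f : (i : Fin N) → SubState n i → OtherStates n i → ℝ → SubState n i} {s : ℝ}
    {x : ℝ → TotalState n} (hx : IsSolution (interconnection f) s x) (i : Fin N) :
    IsSolutionWithInput (f i) s (fun t => x t i) (fun t j => x t j.1) := by
  have hd : ∀ j, ∀ t ∈ Ico 0 s, HasDerivWithinAt (fun t => x t j)
      (f j (x t j) (fun k => x t k.1) t) (Ico 0 s) t := fun j t ht =>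
    (PiLp.proj 2 (fun i : Fin N => SubState n i) j : TotalState n →L[ℝ] SubState n j)
      |>.hasFDerivAt.comp_hasDerivWithinAt t (hx t ht)
  exact ⟨continuousOn_pi.2 fun j t ht => (hd j.1 t ht).continuousWithinAt, hd i⟩

open Matrix in
/-- If `V' ≤ φ A V` componentwise and `vᵀ A = -1ᵀ` with `v > 0`, then the components of `V` decay
exponentially with the rate `l φ`, where `l vᵢ ≤ 1`. -/
lemma le_exp_of_deriv_le_gainMatrix {N : ℕ} {a : Fin N → ℝ} {b : Fin N → Fin N → ℝ}
    {v : Fin N → ℝ} (hv : ∀ i, 0 < v i) (hvA : v ᵥ* gainMatrix a b = -1) {l : ℝ}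
    (hlv : ∀ i, l * v i ≤ 1) {s : ℝ} {φ : ℝ → ℝ} (hφ : ContinuousOn φ (Ico 0 s))
    (hφ0 : ∀ t ∈ Ico 0 s, 0 ≤ φ t) {W : Fin N → ℝ → ℝ} (hW0 : ∀ i, ∀ t ∈ Ico 0 s, 0 ≤ W i t)
    (hW : ∀ i, ∀ t ∈ Ico 0 s, ∃ w : ℝ, HasDerivWithinAt (W i) w (Ico 0 s) t ∧
      w ≤ φ t * (-(a i) * W i t + ∑ j ∈ Finset.univ.erase i, b i j * W j t))
    (i : Fin N) {t : ℝ} (ht : t ∈ Ico 0 s) :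
    W i t ≤ (∑ j, v j * W j 0) / v i * Real.exp (-∫ r in (0 : ℝ)..t, l * φ r) := by
  have key := le_mul_exp_neg_integral (s := s) (φ := fun r => l * φ r)
    (w := fun r => ∑ j, v j * W j r) (continuousOn_const.mul hφ) (fun r hr => by
      choose w hw1 hw2 using fun j => hW j r hr
      refine ⟨∑ j, v j * w j, HasDerivWithinAt.fun_sum fun j _ => (hw1 j).const_mul (v j), ?_⟩
      have hrow : ∀ j, -(a j) * W j r + ∑ k ∈ Finset.univ.erase j, b j k * W k r
          = ∑ k, gainMatrix a b j k * W k r := by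
        intro j
        rw [← Finset.add_sum_erase _ _ (Finset.mem_univ j)]
        congr 1
        · simp [gainMatrix]
        · refine Finset.sum_congr rfl fun k hk => ?_
          simp [gainMatrix, (Finset.ne_of_mem_erase hk).symm]
      calc ∑ j, v j * w j
          ≤ ∑ j, v j * (φ r * ∑ k, gainMatrix a b j k * W k r) :=
            Finset.sum_le_sum fun j _ =>
              mul_le_mul_of_nonneg_left ((hw2 j).trans_eq (by rw [hrow])) (hv j).le
        _ = φ r * ((v ᵥ* gainMatrix a b) ⬝ᵥ fun k => W k r) := by
            rw [← Matrix.dotProduct_mulVec]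
            simp only [dotProduct, mulVec, Finset.mul_sum]
            exact Finset.sum_congr rfl fun j _ => Finset.sum_congr rfl fun k _ => by ring
        _ = φ r * ∑ k, -W k r := by rw [hvA]; simp [dotProduct]
        _ ≤ φ r * ∑ k, -(l * v k * W k r) := by
            refine mul_le_mul_of_nonneg_left (Finset.sum_le_sum fun k _ => ?_) (hφ0 r hr)
            have := mul_le_mul_of_nonneg_right (hlv k) (hW0 k r hr)
            linarith
        _ = -(l * φ r) * ∑ k, v k * W k r := by
            simp only [Finset.mul_sum]
            exact Finset.sum_congr rfl fun k _ => by ring) t ht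
  rw [div_mul_eq_mul_div, le_div_iff₀ (hv i), mul_comm]
  refine le_trans ?_ key
  exact Finset.single_le_sum (f := fun j => v j * W j t)
    (fun j _ => mul_nonneg (hv j).le (hW0 j t ht)) (Finset.mem_univ i)

theorem theorem5 (T : ℝ) (hT : 0 < T) (N : ℕ) (n : Fin N → ℕ)
    (f : (i : Fin N) → SubState n i → OtherStates n i → ℝ → SubState n i)
    (hf : ∀ i, ContinuousOn
      (fun p : SubState n i × OtherStates n i × ℝ => f i p.1 p.2.1 p.2.2)
      (Set.univ ×ˢ Set.univ ×ˢ Set.Ico 0 T))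
    (V : (i : Fin N) → SubState n i → ℝ → ℝ)
    (hV : ∀ i, IsPTExpCertificate T (f i) (V i))
    (φ : ℝ → ℝ) (hφ : IsBlowUp T φ)
    (p₀ : ℝ) (hp₀ : 0 < p₀) (hφp₀ : ∀ t ∈ Set.Ico 0 T, p₀ * (T / (T - t)) ^ 2 ≤ φ t)
    (a : Fin N → ℝ) (ha : ∀ i, 0 < a i)
    (b : Fin N → Fin N → ℝ) (hb : ∀ i j, i ≠ j → 0 < b i j)
    -- the differential inequalities along all solutions of the interconnection
    (hdV : ∀ s ∈ Set.Ioc 0 T, ∀ x : ℝ → TotalState n, IsSolution (interconnection f) s x →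
      ∀ i, ∀ t ∈ Set.Ico 0 s, ∃ v : ℝ,
        HasDerivWithinAt (fun τ => V i (x τ i) τ) v (Set.Ico 0 s) t ∧
        v ≤ φ t * (-(a i) * V i (x t i) t
          + ∑ j ∈ Finset.univ.erase i, b i j * V j (x t j) t))
    (hA : IsHurwitz (gainMatrix a b)) :
    (∀ x : ℝ → TotalState n, IsSolution (interconnection f) T x →
      Filter.Tendsto x (nhdsWithin T (Set.Iio T)) (nhds 0)) ∧
    ((∀ i, IsUniformCertificate T (f i) (V i)) → IsPTC T (interconnection f)) := by
  obtain ⟨v, hv, hvA⟩ := exists_pos_vecMul_eq_neg_one (A := gainMatrix a b)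
    (fun i j hij => by simpa [gainMatrix, hij] using (hb i j hij).le) hA
  have hv0 : 0 ≤ ∑ i, v i := Finset.sum_nonneg fun i _ => (hv i).le
  -- The `1` keeps the denominator positive when `N = 0`.
  set l : ℝ := (1 + ∑ i, v i)⁻¹ with hl
  have hl0 : 0 < l := inv_pos.2 (by linarith)
  have hlv : ∀ i, l * v i ≤ 1 := by
    intro i
    have h1 : v i ≤ ∑ i, v i :=
      Finset.single_le_sum (fun i _ => (hv i).le) (Finset.mem_univ i)
    rw [hl, inv_mul_le_one₀ (by linarith)]
    linarith
  have hψ := hφ.const_mul hl0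
  have hψp : ∀ t ∈ Ico 0 T, l * p₀ * (T / (T - t)) ^ 2 ≤ l * φ t := fun t ht => by
    rw [mul_assoc]
    exact mul_le_mul_of_nonneg_left (hφp₀ t ht) hl0.le
  have hφ0 : ∀ t ∈ Ico 0 T, 0 ≤ φ t := by
    obtain ⟨c, hc, h⟩ := hφ.lower_bound
    exact fun t ht => hc.le.trans (h t ht)
  have hdecay : ∀ s ∈ Ioc 0 T, ∀ x : ℝ → TotalState n, IsSolution (interconnection f) s x →
      ∀ i, ∀ t ∈ Ico 0 s, V i (x t i) t ≤
        (∑ j, v j * V j (x 0 j) 0) / v i * Real.exp (-∫ r in (0 : ℝ)..t, l * φ r) := by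
    intro s hs x hx i t ht
    have hsub : Ico 0 s ⊆ Ico 0 T := Ico_subset_Ico_right hs.2
    exact le_exp_of_deriv_le_gainMatrix (W := fun i t => V i (x t i) t) hv hvA hlv
      (hφ.contDiffOn.continuousOn.mono hsub) (fun t ht => hφ0 t (hsub ht))
      (fun i t ht => (hV i).nonneg _ t (hsub ht)) (hdV s hs x hx) i ht
  have h0T : (0 : ℝ) ∈ Ico 0 T := ⟨le_rfl, hT⟩
  have hC0 : ∀ y : TotalState n, 0 ≤ ∑ j, v j * V j (y j) 0 := fun y =>
    Finset.sum_nonneg fun j _ => mul_nonneg (hv j).le ((hV j).nonneg _ 0 h0T)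
  refine ⟨fun x hx => ?_, fun hU => ?_⟩
  · have hcomp : ∀ i, Tendsto (fun t => x t i) (𝓝[<] T) (𝓝 0) := fun i => by
      have hc := div_nonneg (hC0 (x 0)) (hv i).le
      -- The `+ 1` makes the constant strictly positive even if `W(0) = 0`.
      refine (hV i).tendsto_zero _ _ (hx.component i) ⟨0, h0T,
        (∑ j, v j * V j (x 0 j) 0) / v i + 1, by linarith, fun t => l * φ t, hψ,
        ⟨l * p₀, mul_pos hl0 hp₀, fun t ht => hψp t (Ioo_subset_Ico_self ht)⟩, fun t ht => ?_⟩
      have ht' := Ioo_subset_Ico_self ht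
      rw [abs_of_nonneg ((hV i).nonneg _ t ht')]
      refine (hdecay T ⟨hT, le_rfl⟩ x hx i t ht').trans ?_
      exact mul_le_mul_of_nonneg_right (by linarith) (Real.exp_pos _).le
    refine squeeze_zero_norm (fun t => norm_le_sum_norm_apply (x t)) ?_
    simpa using tendsto_finsetSum Finset.univ fun i _ => (hcomp i).norm
  · choose β μ hβ hμ hbound using fun i =>
      (hU i).bound (fun t => l * φ t) hψ ⟨l * p₀, mul_pos hl0 hp₀, hψp⟩
    have hVc : ∀ j, Continuous fun y : SubState n j => V j y 0 := fun j =>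
      (hV j).continuousOn.comp_continuous (continuous_id.prodMk continuous_const) fun y => ⟨mem_univ _, h0T⟩
    obtain ⟨α, hαc, hαm, hα0, hα⟩ := exists_monotone_bound_of_continuous
      (h := fun y : TotalState n => ∑ j, v j * V j (y j) 0)
      (continuous_finsetSum _ fun j _ => continuous_const.mul
        ((hVc j).comp (PiLp.continuous_apply 2 _ j)))
      (by simp [(hU _).map_zero])
    -- With `r = ‖x 0‖`, `g i r` dominates the argument `‖xᵢ(0)‖ + W(0) / vᵢ` of `β i`.
    obtain ⟨γ, hγ, hγle⟩ := exists_isClassKL_sum hT (g := fun i r => r + α r / v i) hβ hμ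
      (fun i => continuous_id.add (hαc.div_const _))
      (fun i x hx y hy hxy => add_le_add hxy (div_le_div_of_nonneg_right (hαm hx hy hxy) (hv i).le))
      (fun i => by simp [hα0])
    refine ⟨γ, fun t => T / (T - t), hγ, isBlowUp_div_sub hT, fun s hs x hx t ht => ?_⟩
    have htT : t ∈ Ico 0 T := ⟨ht.1, ht.2.trans_le hs.2⟩
    refine le_trans ?_ (hγle ‖x 0‖ (norm_nonneg _) t htT)
    refine (norm_le_sum_norm_apply (x t)).trans (Finset.sum_le_sum fun i _ => ?_)
    have hc := div_nonneg (hC0 (x 0)) (hv i).le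
    have h1 := hbound i s hs _ _ (hx.component i) _ hc (hdecay s hs x hx i) t ht
    have h2 : 0 ≤ μ i t - μ i 0 := sub_nonneg.2 ((hμ i).monotoneOn h0T htT ht.1)
    have h3 : (∑ j, v j * V j (x 0 j) 0) / v i ≤ α ‖x 0‖ / v i :=
      div_le_div_of_nonneg_right (hα (x 0)) (hv i).le
    refine h1.trans (((hβ i).classK _ h2).strictMonoOn.monotoneOn ?_ ?_ ?_)
    · exact add_nonneg (norm_nonneg _) hc
    · exact add_nonneg (norm_nonneg _) (hc.trans h3)
    · exact add_le_add (PiLp.norm_apply_le (x 0) i) h3
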